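/- Let $q$ be a prime power, $n\ge 1$, and let $\sigma:a\mapsto a^q$ be the $q$-Frobenius on $\mathbb{F}_{q^n}$. Let $\mathbb{F}_{q^n}[x;\sigma]$ be the skew-polynomial ring (coefficients on the left, $xa=\sigma(a)x$ for $a\in\mathbb{F}_{q^n}$). A skew polynomial $g$ is a right divisor of $f$ if $f=hg$ for some $h\in\mathbb{F}_{q^n}[x;\sigma]$; for $a\in\mathbb{F}_{q^n}$ we write $g(a)=0$ if the remainder of the right division of $g$ by $x-a$ is zero, i.e. if $x-a$ is a right divisor of $g$. Let $f=x^n-1$ and let $g\in\mathbb{F}_{q^n}[x;\sigma]$ be a right divisor of $f$. Let $$\mathcal{C}=\Big\{(c_0,\dots,c_{n-1})\in\mathbb{F}_{q^n}^n \;:\; \overline{\textstyle\sum_{i=0}^{n-1}c_ix^i}\in {}^{\bullet}(\overline{g})\Big\},$$ where bars denote cosets in the left module $\mathbb{F}_{q^n}[x;\sigma]/\mathbb{F}_{q^n}[x;\sigma]f$ and ${}^{\bullet}(\overline{g})$ is the left submodule generated by $\overline{g}$. Let $\alpha\in\mathbb{F}_{q^n}$ be such that $\alpha,\alpha^q,\dots,\alpha^{q^{n-1}}$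 is a (normal) basis of $\mathbb{F}_{q^n}$ over $\mathbb{F}_q$, and set $\beta=\alpha^{-1}\sigma(\alpha)=\alpha^{q-1}$. Suppose there exist integers $\delta,t_1,t_2\ge 1$ and $b,\nu\ge 0$ such that $\gcd(n,t_1)=1$, $\gcd(n,t_2)<\delta$ and $$g\big(\beta^{q^{b+it_1+jt_2}}\big)=0\quad\text{for } i=0,\dots,\delta-2 \text{ and } j=0,\dots,\nu .$$ Then $\mathcal{C}$ has minimum Hamming distance at least $\delta+\nu$ (the zero code having minimum distance $\infty$ by convention). -/

import Mathlib

/-- A copy of the field `F` on which the natural numbers act through the powers of the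
automorphism `σ`. It serves as the coefficient ring that turns Mathlib's `SkewPolynomial`
into the skew-polynomial ring `F[x;σ]`. -/
def Twist {F : Type*} [Field F] (_σ : F ≃+* F) : Type _ := F

instance Twist.instField {F : Type*} [Field F] (σ : F ≃+* F) : Field (Twist σ) :=
  inferInstanceAs (Field F)

instance Twist.instAction {F : Type*} [Field F] (σ : F ≃+* F) :
    MulSemiringAction (Multiplicative ℕ) (Twist σ) :=
  MulSemiringAction.compHom (M := F ≃+* F) F (powersHom (F ≃+* F) σ)

/-- The identity map, regarded as an isomorphism from `F` to its copy. -/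
def Twist.of {F : Type*} [Field F] (σ : F ≃+* F) : F ≃+* Twist σ := RingEquiv.refl F

theorem Twist.phi_of {F : Type*} [Field F] (σ : F ≃+* F) (a : F) :
    SkewPolynomial.φ (Twist.of σ a) = Twist.of σ (σ a) := rfl

/-- The skew-polynomial ring `F[x;σ]`, with coefficients on the left and `x a = σ(a) x`. -/
abbrev SkewPoly {F : Type*} [Field F] (σ : F ≃+* F) : Type _ := SkewPolynomial (Twist σ)

namespace SkewPoly

variable {F : Type*} [Field F] (σ : F ≃+* F)

/-- The constants of `F[x;σ]`. -/
noncomputable def C : F →+* SkewPoly σ :=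
  (SkewPolynomial.CRingHom (R := Twist σ)).comp (Twist.of σ).toRingHom

/-- The indeterminate `x` of `F[x;σ]`. -/
noncomputable def X : SkewPoly σ := SkewPolynomial.X

/-- The defining relation `x a = σ(a) x`. -/
theorem X_mul_C (a : F) : X σ * C σ a = C σ (σ a) * X σ := by
  have hC (c : F) : C σ c = SkewPolynomial.monomial 0 (Twist.of σ c) := rfl
  rw [hC, hC, X, SkewPolynomial.X_mul_monomial, SkewPolynomial.monomial_mul_X, Twist.phi_of]

variable {σ}

/-- `g` is a right divisor of `f`. -/
def RightDvd (g f : SkewPoly σ) : Prop := ∃ h : SkewPoly σ, f = h * g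

/-- `f(a) = 0`: the remainder of the right division of `f` by `x - a` is zero, in other words
`x - a` is a right divisor of `f`. -/
def IsRightRoot (f : SkewPoly σ) (a : F) : Prop := RightDvd (X σ - C σ a) f

/-- The left `F[x;σ]`-module `F[x;σ] / F[x;σ] f`. -/
abbrev QuotientModule (f : SkewPoly σ) : Type _ :=
  SkewPoly σ ⧸ Submodule.span (SkewPoly σ) {f}

/-- The coset of the skew polynomial `z` modulo the left ideal `F[x;σ] f`. -/
noncomputable def coset (f z : SkewPoly σ) : QuotientModule f := Submodule.Quotient.mk z

/-- The map `(c₀, …, cₙ₋₁) ↦ c₀ + c₁ x + ⋯ + cₙ₋₁ xⁿ⁻¹` from `Fⁿ` to `F[x;σ] / F[x;σ] f`. It is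
bijective when `f` is monic of degree `n`. -/
noncomputable def polynomialize (f : SkewPoly σ) (n : ℕ) (c : Fin n → F) : QuotientModule f :=
  coset f (∑ i : Fin n, C σ (c i) * X σ ^ (i : ℕ))

/-- The code in `Fⁿ` that corresponds to the left submodule of `F[x;σ] / F[x;σ] f` generated by
the coset of `g`: all vectors whose polynomialization lies in this submodule. -/
noncomputable def code (f g : SkewPoly σ) (n : ℕ) : Submodule F (Fin n → F) where
  carrier := {c | polynomialize f n c ∈ Submodule.span (SkewPoly σ) {coset f g}}
  add_mem' := by
    intro a b ha hb
    have h : polynomialize f n (a + b) = polynomialize f n a + polynomialize f n b := by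
      simp only [polynomialize, coset, Pi.add_apply, map_add, add_mul, Finset.sum_add_distrib]
      rfl
    rw [Set.mem_ofPred_eq, h]
    exact add_mem ha hb
  zero_mem' := by
    have h : polynomialize f n 0 = 0 := by
      simp only [polynomialize, coset, Pi.zero_apply, map_zero, zero_mul, Finset.sum_const_zero]
      rfl
    rw [Set.mem_ofPred_eq, h]
    exact zero_mem _
  smul_mem' := by
    intro a c hc
    have h : polynomialize f n (a • c) = C σ a • polynomialize f n c := by
      simp only [polynomialize, coset, Pi.smul_apply, smul_eq_mul, map_mul, mul_assoc,
        ← Finset.mul_sum]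
      rfl
    rw [Set.mem_ofPred_eq, h]
    exact Submodule.smul_mem _ _ hc

end SkewPoly

/-- The minimum (Hamming) distance of a linear code: the infimum of the distances between distinct
codewords, which is `⊤` for the zero code. -/
noncomputable def minDistance {F : Type*} [Field F] [DecidableEq F] {n : ℕ}
    (𝒞 : Submodule F (Fin n → F)) : ℕ∞ :=
  ⨅ (x : Fin n → F) (_ : x ∈ 𝒞) (y : Fin n → F) (_ : y ∈ 𝒞) (_ : x ≠ y), (hammingDist x y : ℕ∞)

/-- The automorphism `a ↦ a ^ q` of the finite field `F`, where `q` is the cardinality of the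
subfield `K`. -/
noncomputable def qFrobenius (K F : Type*) [Field K] [Fintype K] [Field F] [Finite F]
    [Algebra K F] : F ≃+* F :=
  (FiniteField.frobeniusAlgEquivOfAlgebraic K F : F ≃ₐ[K] F).toRingEquiv

theorem qFrobenius_apply (K F : Type*) [Field K] [Fintype K] [Field F] [Finite F]
    [Algebra K F] (a : F) : qFrobenius K F a = a ^ Fintype.card K := rfl

/-! ### Galois descent and dimensions of spaces of relations -/

section Descent

variable {F ι : Type*} [Field F] [Fintype ι]

/-! Let `x` act on `F` as `σ`. For `u = σ^k(α)` one has `σ(u) = σ^k(β) u`, so each root `σ^k(β)` of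
`g` gives every codeword a relation `∑ c_s σ^k(a_s) = 0`, where `a_s = σ^s(α)`. On the support of a
nonzero codeword, consider the spaces of all vectors satisfying such relations. Starting from the
whole space, impose the exponent `b`, then `b + i t₁` for one more `i` at a time (`δ - 2` steps),
then one more `j` at a time (`ν` steps). The last space is nonzero and every inclusion is strict, so
the support has at least `1 + (δ - 2) + ν + 1 = δ + ν` elements. For strictness: an equality would
make a space stable under `σ^(-t)`, with `t = t₁` or `t₂`. Galois descent
(`exists_fixed_ne_zero_of_stable`) then yields a nonzero vector fixed by `σ^t`, which
`eq_zero_of_fixed_of_relations` rules out by independence of the normal basis. -/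

theorem exists_fixed_ne_zero_of_stable (σ : F ≃+* F) (D : Submodule F (ι → F))
    (hσ : ∀ v ∈ D, (fun s => σ (v s)) ∈ D) (hD : D ≠ ⊥) :
    ∃ v ∈ D, v ≠ 0 ∧ ∀ s, σ (v s) = v s := by
  classical
  obtain ⟨v₀, hv₀, hv₀'⟩ := Submodule.exists_mem_ne_zero_of_ne_bot hD
  obtain ⟨v, ⟨hvD, hv⟩, hmin⟩ := exists_minimalFor_of_wellFoundedLT
    (fun v : ι → F => v ∈ D ∧ v ≠ 0) hammingNorm ⟨v₀, hv₀, hv₀'⟩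
  obtain ⟨s₀, hs₀⟩ := Function.ne_iff.mp hv
  rw [Pi.zero_apply] at hs₀
  -- `v` has minimal weight in `D`. Once it is scaled to be 1 at `s₀`, the difference `σ(u) - u` has
  -- strictly smaller support and must vanish.
  have hlt (w : ι → F) (hw : w ∈ D) (hsub : ∀ s, v s = 0 → w s = 0) (h0 : w s₀ = 0) : w = 0 := by
    by_contra hne
    refine absurd (hmin ⟨hw, hne⟩) (fun h => ?_)
    have hlt : hammingNorm w < hammingNorm v := by
      refine Finset.card_lt_card ((Finset.ssubset_iff_of_subset fun s hs => ?_).mpr ⟨s₀, ?_, ?_⟩)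
      · simp only [Finset.mem_filter, Finset.mem_univ, true_and] at hs ⊢
        exact fun h => hs (hsub s h)
      · simpa using hs₀
      · simpa using h0
    exact absurd (h hlt.le) hlt.not_ge
  set u : ι → F := (v s₀)⁻¹ • v with hu
  have huD : u ∈ D := D.smul_mem _ hvD
  have hu1 : u s₀ = 1 := by simp [hu, hs₀]
  have hfix : (fun s => σ (u s)) - u = 0 := by
    refine hlt _ (D.sub_mem (hσ u huD) huD) (fun s hs => ?_) ?_
    · simp [hu, hs]
    · simp [hu1]
  refine ⟨u, huD, fun h => ?_, fun s => ?_⟩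
  · rw [h, Pi.zero_apply] at hu1
    exact zero_ne_one hu1
  · simpa [sub_eq_zero] using congrFun hfix s

/-- The vectors `c` with `∑ s, c s * σ ^ k (a s) = 0` for all exponents `k ∈ T`. -/
def twistedRelations (σ : F ≃+* F) (a : ι → F) (T : Set ℕ) : Submodule F (ι → F) where
  carrier := {c | ∀ k ∈ T, ∑ s, c s * (σ ^ k) (a s) = 0}
  add_mem' {c d} hc hd k hk := by
    simp only [Pi.add_apply, add_mul, Finset.sum_add_distrib, hc k hk, hd k hk, add_zero]
  zero_mem' k _ := by simp
  smul_mem' x c hc k hk := by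
    simp only [Pi.smul_apply, smul_eq_mul, mul_assoc, ← Finset.mul_sum, hc k hk, mul_zero]

variable {σ : F ≃+* F} {a : ι → F}

theorem twistedRelations_anti {S T : Set ℕ} (h : S ⊆ T) :
    twistedRelations σ a T ≤ twistedRelations σ a S :=
  fun _ hc k hk => hc k (h hk)

theorem sum_pow_add (c : ι → F) (t k : ℕ) :
    ∑ s, (σ ^ t) (c s) * (σ ^ (t + k)) (a s) = (σ ^ t) (∑ s, c s * (σ ^ k) (a s)) := by
  simp only [map_sum, map_mul, pow_add, RingAut.mul_apply]

/-- A shift of the relations through `σ ^ t` yields a strictly smaller space, unless there are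
relations with coefficients fixed by `σ ^ t`. -/
theorem finrank_twistedRelations_lt {S T : Set ℕ} (t : ℕ) (hST : S ⊆ T)
    (hshift : ∀ k ∈ S, t + k ∈ T)
    (hfix : ∀ c ∈ twistedRelations σ a S, (∀ s, (σ ^ t) (c s) = c s) → c = 0)
    (hT : twistedRelations σ a T ≠ ⊥) :
    Module.finrank F (twistedRelations σ a T) < Module.finrank F (twistedRelations σ a S) := by
  refine Submodule.finrank_lt_finrank_of_lt (lt_of_le_of_ne (twistedRelations_anti hST) fun h => ?_)
  -- If the two spaces agree, relations also hold at `t + k` for `k ∈ S`; undoing `σ ^ t` brings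
  -- them back to `k`.
  have hstable : ∀ v ∈ twistedRelations σ a S,
      (fun s => (σ ^ t).symm (v s)) ∈ twistedRelations σ a S := by
    intro v hv k hk
    rw [← h] at hv
    apply (σ ^ t).injective
    rw [← sum_pow_add, map_zero]
    simpa using hv _ (hshift k hk)
  obtain ⟨v, hv, hne, hfv⟩ := exists_fixed_ne_zero_of_stable _ _ hstable (h ▸ hT)
  refine hne (hfix v hv fun s => ?_)
  rw [← (σ ^ t).symm_apply_eq.mp (hfv s)]

/-- The spaces decrease, so if the last one is nonzero, all are, and each of the `m` inclusions
costs a dimension. -/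
theorem finrank_twistedRelations_add_le {T : ℕ → Set ℕ} (t : ℕ) (hT : Monotone T)
    (hshift : ∀ j, ∀ k ∈ T j, t + k ∈ T (j + 1))
    (hfix : ∀ c ∈ twistedRelations σ a (T 0), (∀ s, (σ ^ t) (c s) = c s) → c = 0)
    (m : ℕ) (hm : twistedRelations σ a (T m) ≠ ⊥) :
    Module.finrank F (twistedRelations σ a (T m)) + m ≤
      Module.finrank F (twistedRelations σ a (T 0)) := by
  induction m with
  | zero => rfl
  | succ m ih =>
    have hle : twistedRelations σ a (T (m + 1)) ≤ twistedRelations σ a (T m) :=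
      twistedRelations_anti (hT m.le_succ)
    have h1 := ih fun h => hm (le_bot_iff.mp (h ▸ hle))
    have h2 := finrank_twistedRelations_lt t (hT (Nat.le_add_right m 1)) (hshift m)
      (fun c hc => hfix c (twistedRelations_anti (hT m.zero_le) hc)) hm
    omega

theorem pow_gcd_apply_eq_self {x : F} {m n : ℕ} (hm : (σ ^ m) x = x) (hn : (σ ^ n) x = x) :
    (σ ^ m.gcd n) x = x := by
  have hiff (k : ℕ) : (σ ^ k) x = x ↔ Function.IsPeriodicPt σ k x := by
    rw [RingAut.coe_pow]; rfl
  rw [hiff] at *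
  exact hm.gcd hn

variable {n : ℕ}

/-- Relations with coefficients in the fixed field of `σ ^ t` vanish as soon as they hold for as
many conjugates as the degree of this field. -/
theorem eq_zero_of_fixed_of_relations (hσ : σ ^ n = 1)
    (ha : ∀ c : ι → F, (∀ s, σ (c s) = c s) → ∑ s, c s * a s = 0 → c = 0)
    {t₁ t m b : ℕ} (ht₁ : n.gcd t₁ = 1) (hn : 0 < n) (hm : n.gcd t ≤ m)
    {c : ι → F} (hc : ∀ s, (σ ^ t) (c s) = c s)
    (hrel : ∀ i < m, ∑ s, c s * (σ ^ (b + i * t₁)) (a s) = 0) : c = 0 := by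
  have hpow (x : F) : (σ ^ n) x = x := by rw [hσ]; rfl
  have hd : 0 < n.gcd t := Nat.gcd_pos_of_pos_left _ hn
  have hcd (s : ι) : (σ ^ (t₁ * n.gcd t)) (c s) = c s := by
    have h : (σ ^ n.gcd t) (c s) = c s := pow_gcd_apply_eq_self (hpow _) (hc s)
    rw [mul_comm, pow_mul, RingAut.coe_pow]
    exact Function.iterate_fixed h t₁
  -- Since `σ ^ (t₁ * n.gcd t)` fixes `c`, applying it moves the relation of index `i` to index `i +
  -- n.gcd t`; the first `n.gcd t` relations thus imply all others.
  have hall : ∀ i, ∑ s, c s * (σ ^ (b + i * t₁)) (a s) = 0 := by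
    intro i
    induction i using Nat.strong_induction_on with
    | _ i ih =>
      rcases lt_or_ge i (n.gcd t) with hi | hi
      · exact hrel i (hi.trans_le hm)
      · obtain ⟨i, rfl⟩ := Nat.exists_eq_add_of_le hi
        have h := sum_pow_add (σ := σ) (a := a) c (t₁ * n.gcd t) (b + i * t₁)
        rw [ih i (by omega), map_zero] at h
        simp only [hcd] at h
        rw [← h]
        refine Finset.sum_congr rfl fun s _ => ?_
        congr 3
        ring
  set D := twistedRelations σ a (Set.range fun i => b + i * t₁) with hD
  by_contra hne
  have hcD : c ∈ D := by
    rintro _ ⟨i, rfl⟩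
    exact hall i
  -- The exponents are now closed under adding `t₁`. A second descent gives a vector fixed by `σ ^
  -- t₁`, hence by `σ` because `n.gcd t₁ = 1`.
  have hstable : ∀ v ∈ D, (fun s => (σ ^ t₁).symm (v s)) ∈ D := by
    rintro v hv _ ⟨i, rfl⟩
    apply (σ ^ t₁).injective
    rw [← sum_pow_add, map_zero]
    have h := hv _ ⟨i + 1, rfl⟩
    simp only [RingEquiv.apply_symm_apply]
    rw [← h]
    refine Finset.sum_congr rfl fun s _ => ?_
    congr 3
    ring
  obtain ⟨v, hv, hv0, hfv⟩ := exists_fixed_ne_zero_of_stable _ D hstable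
    (fun h => hne (by simpa [h] using hcD))
  have hfix (s : ι) : σ (v s) = v s := by
    have h := pow_gcd_apply_eq_self (hpow _) ((σ ^ t₁).symm_apply_eq.mp (hfv s)).symm
    rwa [ht₁, pow_one] at h
  refine hv0 (ha v hfix ?_)
  have h := hv _ ⟨0, rfl⟩
  apply (σ ^ b).injective
  have h2 := sum_pow_add (σ := σ) (a := a) v b 0
  simp only [pow_zero, RingAut.one_apply] at h2
  rw [← h2, map_zero, ← h]
  refine Finset.sum_congr rfl fun s _ => ?_
  rw [RingAut.coe_pow, Function.iterate_fixed (hfix s)]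
  simp

/-- A Roos-type bound: a nonzero relation that holds for the exponents `b + i t₁ + j t₂` has
length at least `δ + ν`. -/
theorem add_le_card_of_relation (hσ : σ ^ n = 1)
    (ha : ∀ c : ι → F, (∀ s, σ (c s) = c s) → ∑ s, c s * a s = 0 → c = 0)
    {δ t₁ t₂ b ν : ℕ} (hn : 0 < n) (ht₁ : n.gcd t₁ = 1) (ht₂ : n.gcd t₂ < δ)
    {c : ι → F} (hc : c ≠ 0)
    (hrel : ∀ i j : ℕ, i + 2 ≤ δ → j ≤ ν →
      ∑ s, c s * (σ ^ (b + i * t₁ + j * t₂)) (a s) = 0) :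
    δ + ν ≤ Fintype.card ι := by
  have hd : 0 < n.gcd t₂ := Nat.gcd_pos_of_pos_left _ hn
  -- `δ ≥ 2` because `1 ≤ n.gcd t₂ < δ`.
  obtain ⟨m, rfl⟩ : ∃ m, δ = m + 2 := ⟨δ - 2, by omega⟩
  let S : ℕ → Set ℕ := fun m => {k | ∃ i ≤ m, k = b + i * t₁}
  let T : ℕ → Set ℕ := fun ν => {k | ∃ i ≤ m, ∃ j ≤ ν, k = b + i * t₁ + j * t₂}
  have hTS : T 0 = S m := by
    ext k
    simp [T, S]
  have hcT : c ∈ twistedRelations σ a (T ν) := by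
    rintro _ ⟨i, hi, j, hj, rfl⟩
    exact hrel i j (by omega) hj
  have hTbot : twistedRelations σ a (T ν) ≠ ⊥ := (Submodule.ne_bot_iff _).mpr ⟨c, hcT, hc⟩
  have hT : Monotone T := by
    rintro p r hpr _ ⟨i, hi, j, hj, rfl⟩
    exact ⟨i, hi, j, hj.trans hpr, rfl⟩
  have hS : Monotone S := by
    rintro p r hpr _ ⟨i, hi, rfl⟩
    exact ⟨i, hi.trans hpr, rfl⟩
  have hSbot : twistedRelations σ a (S m) ≠ ⊥ := by
    rw [← hTS]
    exact fun h => hTbot (le_bot_iff.mp (h ▸ twistedRelations_anti (hT ν.zero_le)))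
  -- Shifts by `t₂` need `n.gcd t₂` relations, and `m + 1 = δ - 1` are available.
  have h1 := finrank_twistedRelations_add_le (σ := σ) (a := a) t₂ hT
    (by
      rintro j _ ⟨i, hi, j', hj', rfl⟩
      exact ⟨i, hi, j' + 1, by omega, by ring⟩)
    (fun v hv hfix => eq_zero_of_fixed_of_relations hσ ha (m := m + 1) (b := b) ht₁ hn
      (by omega) hfix (fun i hi => hv _ ⟨i, by omega, 0, le_rfl, by ring⟩))
    ν hTbot
  -- Shifts by `t₁` need a single relation, since `n.gcd t₁ = 1`.
  have h2 := finrank_twistedRelations_add_le (σ := σ) (a := a) t₁ hS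
    (by
      rintro j _ ⟨i, hi, rfl⟩
      exact ⟨i + 1, by omega, by ring⟩)
    (fun v hv hfix => eq_zero_of_fixed_of_relations hσ ha (m := 1) (b := b) ht₁ hn
      ht₁.le hfix (fun i hi => hv _ ⟨i, by omega, rfl⟩))
    m hSbot
  -- A standard basis vector is fixed by every power of `σ`, so it cannot satisfy the relation at
  -- `b`.
  have h3 : Module.finrank F (twistedRelations σ a (S 0)) < Fintype.card ι := by
    rw [← Module.finrank_fintype_fun_eq_card F]
    refine Submodule.finrank_lt fun htop => ?_
    classical
    obtain ⟨s, -⟩ := Function.ne_iff.mp hc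
    have hs : (Pi.single s (1 : F) : ι → F) = 0 := eq_zero_of_fixed_of_relations hσ ha (m := 1)
      (t := t₁) (b := b) ht₁ hn ht₁.le (c := (Pi.single s (1 : F) : ι → F))
      (fun r => by by_cases h : r = s <;> simp [h])
      (fun i hi => by
        have h : (Pi.single s (1 : F) : ι → F) ∈ twistedRelations σ a (S 0) := htop ▸ Submodule.mem_top
        exact h _ ⟨i, by omega, rfl⟩)
    simpa using congrFun hs s
  have h4 := Submodule.one_le_finrank_iff.mpr hTbot
  rw [hTS] at h1
  omega

end Descent

/-! ### From codewords to relations, by evaluation at `σ` -/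

namespace SkewPoly

variable {F : Type*} [Field F] (σ : F ≃+* F)

/-- The action of `F[x;σ]` on `F` in which `x` acts as `σ` and constants act by multiplication. -/
noncomputable def operator : SkewPoly σ →+* AddMonoid.End F :=
  SkewMonoidAlgebra.liftNCRingHom
    ((Module.toAddMonoidEnd F F).comp (Twist.of σ).symm.toRingHom)
    ((DistribMulAction.toAddMonoidEnd (F ≃+* F) F).comp (powersHom (F ≃+* F) σ))
    (by
      intro x y
      ext z
      exact (map_mul (σ ^ y.toAdd) x z).symm)

theorem operator_mul_apply (f g : SkewPoly σ) (u : F) :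
    operator σ (f * g) u = operator σ f (operator σ g u) := by
  rw [map_mul]
  rfl

theorem operator_monomial (k : ℕ) (a u : F) :
    operator σ (SkewPolynomial.monomial k (Twist.of σ a)) u = a * (σ ^ k) u := by
  have h : operator σ (SkewPolynomial.monomial k (Twist.of σ a)) = _ :=
    SkewMonoidAlgebra.liftNC_single _ _ _ _
  rw [h]
  rfl

theorem operator_C (a u : F) : operator σ (C σ a) u = a * u :=
  operator_monomial σ 0 a u

theorem operator_X (u : F) : operator σ (X σ) u = σ u :=
  (operator_monomial σ 1 1 u).trans (by rw [one_mul, pow_one])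

theorem operator_X_pow (k : ℕ) (u : F) : operator σ (X σ ^ k) u = (σ ^ k) u := by
  induction k generalizing u with
  | zero => rw [pow_zero, map_one]; rfl
  | succ k ih => rw [pow_succ, operator_mul_apply, ih, operator_X, pow_succ, RingAut.mul_apply]

variable {σ}

theorem RightDvd.operator_eq_zero {f g : SkewPoly σ} (h : RightDvd g f) {u : F}
    (hu : operator σ g u = 0) : operator σ f u = 0 := by
  obtain ⟨r, rfl⟩ := h
  rw [operator_mul_apply, hu, map_zero]

theorem IsRightRoot.operator_eq_zero {f : SkewPoly σ} {a u : F} (h : IsRightRoot f a)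
    (hu : σ u = a * u) : operator σ f u = 0 := by
  refine RightDvd.operator_eq_zero h ?_
  rw [map_sub]
  exact sub_eq_zero.mpr
    ((operator_X σ u).trans (hu.trans (operator_C σ a u).symm))

/-- As `g` right-divides `f`, the left ideal of `g` contains that of `f`, so reduction modulo `f`
does not affect divisibility by `g`. -/
theorem rightDvd_of_mem_code {f g : SkewPoly σ} (hg : RightDvd g f) {n : ℕ} {c : Fin n → F}
    (hc : c ∈ code f g n) : RightDvd g (∑ i : Fin n, C σ (c i) * X σ ^ (i : ℕ)) := by
  obtain ⟨h, hh⟩ := Submodule.mem_span_singleton.mp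
    (show polynomialize f n c ∈ Submodule.span (SkewPoly σ) {coset f g} from hc)
  have hh' : (Submodule.Quotient.mk (h * g) : QuotientModule f) =
      Submodule.Quotient.mk (∑ i : Fin n, C σ (c i) * X σ ^ (i : ℕ)) := hh
  obtain ⟨k, hk⟩ := Submodule.mem_span_singleton.mp ((Submodule.Quotient.eq _).mp hh'.symm)
  obtain ⟨l, rfl⟩ := hg
  refine ⟨k * l + h, ?_⟩
  rw [smul_eq_mul] at hk
  rw [add_mul, mul_assoc, hk, sub_add_cancel]

theorem sum_mul_pow_eq_zero_of_mem_code {f g : SkewPoly σ} (hg : RightDvd g f) {n : ℕ}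
    {c : Fin n → F} (hc : c ∈ code f g n) {a u : F} (h : IsRightRoot g a) (hu : σ u = a * u) :
    ∑ i : Fin n, c i * (σ ^ (i : ℕ)) u = 0 := by
  have h0 := (rightDvd_of_mem_code hg hc).operator_eq_zero (h.operator_eq_zero hu)
  rw [map_sum] at h0
  rw [← h0]
  refine Eq.trans (Finset.sum_congr rfl fun i _ => ?_) (AddMonoidHom.finsetSum_apply _ _ _).symm
  exact ((operator_mul_apply σ _ _ u).trans (by rw [operator_C, operator_X_pow])).symm

end SkewPoly

theorem le_minDistance {F : Type*} [Field F] [DecidableEq F] {n d : ℕ}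
    {𝒞 : Submodule F (Fin n → F)} (h : ∀ c ∈ 𝒞, c ≠ 0 → d ≤ hammingNorm c) :
    (d : ℕ∞) ≤ minDistance 𝒞 := by
  refine le_iInf fun x => le_iInf fun hx => le_iInf fun y => le_iInf fun hy => le_iInf fun hxy => ?_
  rw [hammingDist_comm, hammingDist_eq_hammingNorm]
  exact_mod_cast h _ (𝒞.add_mem (𝒞.neg_mem hy) hx) fun h => hxy (neg_add_eq_zero.mp h).symm

/-! ### The Frobenius of `F` over `K` -/

section Frobenius

variable (K F : Type*) [Field K] [Fintype K] [Field F] [Finite F] [Algebra K F]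

theorem qFrobenius_pow_apply (k : ℕ) (x : F) :
    (qFrobenius K F ^ k) x = x ^ Fintype.card K ^ k := by
  induction k generalizing x with
  | zero => simp
  | succ k ih => rw [pow_succ, RingAut.mul_apply, ih, qFrobenius_apply, ← pow_mul, pow_succ']

theorem qFrobenius_pow_finrank : qFrobenius K F ^ Module.finrank K F = 1 := by
  ext x
  have := Fintype.ofFinite F
  rw [qFrobenius_pow_apply, ← Module.card_eq_pow_finrank, FiniteField.pow_card]
  rfl

variable {K F}

/-- Powers of the Frobenius exhaust the Galois group of `F` over `K`. -/
theorem mem_range_algebraMap_of_qFrobenius_eq {x : F} (hx : qFrobenius K F x = x) :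
    x ∈ Set.range (algebraMap K F) := by
  rw [IsGalois.mem_range_algebraMap_iff_fixed]
  intro f
  obtain ⟨k, rfl⟩ := (FiniteField.bijective_frobeniusAlgEquivOfAlgebraic_pow K F).2 f
  rw [AlgEquiv.coe_pow]
  exact Function.iterate_fixed hx _

end Frobenius

theorem mainTheorem7 {K F : Type*} [Field K] [Fintype K] [Field F] [Finite F] [DecidableEq F]
    [Algebra K F] (q n : ℕ) (hq : Fintype.card K = q) (hn : Module.finrank K F = n)
    (g : SkewPoly (qFrobenius K F))
    (hg : SkewPoly.RightDvd g (SkewPoly.X (qFrobenius K F) ^ n - 1))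
    (α : F) (hα : ∃ B : Module.Basis (Fin n) K F, ∀ i : Fin n, B i = α ^ q ^ (i : ℕ))
    (β : F) (hβ : β = α ^ (q - 1))
    (δ t₁ t₂ b ν : ℕ) (hδ : 0 < δ) (ht₁ : 0 < t₁) (ht₂ : 0 < t₂)
    (hnt₁ : Nat.gcd n t₁ = 1) (hnt₂ : Nat.gcd n t₂ < δ)
    (hroots : ∀ i j : ℕ, i + 2 ≤ δ → j ≤ ν →
      SkewPoly.IsRightRoot g (β ^ q ^ (b + i * t₁ + j * t₂))) :
    ((δ + ν : ℕ) : ℕ∞) ≤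
      minDistance (SkewPoly.code (SkewPoly.X (qFrobenius K F) ^ n - 1) g n) := by
  obtain ⟨B, hB⟩ := hα
  subst hq hn hβ
  have hBσ (i : Fin (Module.finrank K F)) : B i = (qFrobenius K F ^ (i : ℕ)) α := by
    rw [hB, qFrobenius_pow_apply]
  refine le_minDistance fun c hc hc0 => ?_
  have hcard : Fintype.card {s // c s ≠ 0} = hammingNorm c := Fintype.card_subtype _
  rw [← hcard]
  refine add_le_card_of_relation (σ := qFrobenius K F) (n := Module.finrank K F)
    (a := fun s : {s // c s ≠ 0} => B s) (c := fun s => c s) (b := b)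
    (qFrobenius_pow_finrank K F) (fun v hv hsum => ?_) Module.finrank_pos hnt₁ hnt₂ ?_ ?_
  · choose w hw using fun s => mem_range_algebraMap_of_qFrobenius_eq (hv s)
    have hli := Fintype.linearIndependent_iff.mp
      (B.linearIndependent.comp (Subtype.val : {s // c s ≠ 0} → _) Subtype.val_injective) w
      (by simpa only [Algebra.smul_def, hw, Function.comp_apply] using hsum)
    ext s
    rw [← hw, hli s, map_zero, Pi.zero_apply]
  · obtain ⟨s, hs⟩ := Function.ne_iff.mp hc0
    exact fun h => hs (congrFun h ⟨s, hs⟩)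
  · intro i j hi hj
    have h := SkewPoly.sum_mul_pow_eq_zero_of_mem_code hg hc (hroots i j hi hj)
      (u := (qFrobenius K F ^ (b + i * t₁ + j * t₂)) α) (by
        rw [qFrobenius_apply, qFrobenius_pow_apply, ← pow_mul, ← pow_mul, ← pow_add]
        congr 1
        obtain ⟨p, hp⟩ : ∃ p, Fintype.card K = p + 1 :=
          ⟨Fintype.card K - 1, (Nat.succ_pred Fintype.card_ne_zero).symm⟩
        rw [hp, Nat.add_sub_cancel]
        ring)
    have hsub := Finset.sum_subtype (p := fun s => c s ≠ 0) (F := inferInstance)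
      (Finset.univ.filter fun s => c s ≠ 0) (by simp)
      fun s => c s * (qFrobenius K F ^ (b + i * t₁ + j * t₂)) (B s)
    rw [← hsub, Finset.sum_filter_of_ne fun s _ h0 => left_ne_zero_of_mul h0]
    refine Eq.trans (Finset.sum_congr rfl fun s _ => ?_) h
    -- Powers of `σ` commute: `σ^k(σ^s(α)) = σ^s(σ^k(α))`, which exchanges the roles of position and
    -- root.
    rw [hBσ, ← RingAut.mul_apply, ← RingAut.mul_apply, ← pow_add, ← pow_add, add_comm]
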